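/- For a positive integer $n$ let $H_n = 1+\frac12+\cdots+\frac1n = \frac{u_n}{v_n}$ with $\gcd(u_n,v_n)=1$ and $v_n>0$. For a set $S$ of positive integers and a real number $x$, let $S(x)=|S\cap[1,x]|$. Then the set of positive integers $n$ such that $v_n$ is divisible by the least common multiple of $1,2,\dots,\lfloor n^{1/4}\rfloor$ has natural density one, that is, its counting function divided by $x$ tends to $1$ as $x\to\infty$. Moreover, the set $T$ of positive integers $n$ for which $v_n$ is not divisible by this least common multiple satisfies $T(x)=O(x/\log x)$ as $x\to\infty$. -/

import Mathlib

open Filter Topology Asymptotics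

namespace HarmonicDen

/-- The counting function `S(x) = |S ∩ [1, x]|` of a set of positive integers
(the set on the right is finite, so `Set.ncard` is its true cardinality). -/
noncomputable def countingFunction (S : Set ℕ) (x : ℝ) : ℕ :=
  Set.ncard {n : ℕ | n ∈ S ∧ 1 ≤ n ∧ (n : ℝ) ≤ x}

/-- `S` has natural (asymptotic) density `d`: `S(x) / x → d` as `x → ∞`. -/
def HasNaturalDensity (S : Set ℕ) (d : ℝ) : Prop :=
  Tendsto (fun x : ℝ => (countingFunction S x : ℝ) / x) atTop (𝓝 d)

/-- The denominator `v n` of the harmonic number `1 + 1/2 + ⋯ + 1/n` in lowest terms. -/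
def v (n : ℕ) : ℕ := (harmonic n).den

/-- The least common multiple of `1, 2, …, k` (equal to `1` for `k = 0`). -/
def lcmUpTo (k : ℕ) : ℕ := (Finset.Icc 1 k).lcm id

/-- The positive integers `n` such that `lcm (1, 2, …, ⌊n ^ (1/4)⌋)` divides `v n`. -/
def goodSet : Set ℕ :=
  {n : ℕ | 0 < n ∧ lcmUpTo ⌊(n : ℝ) ^ (1 / 4 : ℝ)⌋₊ ∣ v n}

/-- The positive integers `n` such that `lcm (1, 2, …, ⌊n ^ (1/4)⌋)` does not divide `v n`. -/
def exceptionalSet : Set ℕ :=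
  {n : ℕ | 0 < n ∧ ¬ lcmUpTo ⌊(n : ℝ) ^ (1 / 4 : ℝ)⌋₊ ∣ v n}

end HarmonicDen

namespace HarmonicDen

/-! The terms 1/m with p ∣ m contribute H_{⌊n/p⌋}/p to H_n, and the rest is p-integral. Hence if p^a
∤ v_n, iterating gives ⌊n/p^a⌋ ∈ J_p, where J_p is `numeratorSet p`. So an exceptional n has a prime
power p^a ≤ n^{1/4} with ⌊n/p^a⌋ ∈ J_p, and it suffices to show that J_p is thin, uniformly in p.

If n and n + d both lie in J_p, then n + 1 is a root mod p of the derivative of X(X+1)⋯(X+d-1),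
which is nonzero for 0 < d < p. Small gaps are therefore rare, and an interval of length L ≤ p meets
J_p in at most 3L^{2/3} points (`card_interval_le`). As J_p is stable under m ↦ ⌊m/p⌋, it is a tree
with few children per node, so J_p has O(3^{log_p y} y^{2/3}) elements up to y.

The union bound over p^a ≤ x^{1/4} has three ranges. Primes p > x^{1/5} occur only with a = 1 and
cost O(x^{3/4}) each; Chebyshev's bound for π(x^{1/4}) then gives x/log x, the dominant term. For
the other p ≥ 3^60 the factor 3^{log_p y} is at most x^{1/60}. For p < 3^60 it is enough that J_p
has no two consecutive elements, which saves a fixed power of x. -/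

/-- The `m` for which `p` divides the numerator of the `m`-th harmonic number. -/
def numeratorSet (p : ℕ) : Set ℕ := {m | padicNorm p (harmonic m) < 1}

/-! ### Reduction of v_n to numerators, p-adically -/

/-- The difference is the sum of 1/m over m ≤ n prime to p. -/
lemma padicNorm_harmonic_sub_le (p : ℕ) [Fact p.Prime] (n : ℕ) :
    padicNorm p (harmonic n - harmonic (n / p) / p) ≤ 1 := by
  have hp : p.Prime := Fact.out
  induction n with
  | zero => simp
  | succ n ih =>
    by_cases h : p ∣ n + 1
    · rw [Nat.succ_div_of_dvd h, harmonic_succ, harmonic_succ]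
      have h1 : ((n + 1 : ℕ) : ℚ) = p * ((n / p + 1 : ℕ) : ℚ) := by
        rw [← Nat.succ_div_of_dvd h]
        exact_mod_cast (Nat.mul_div_cancel' h).symm
      have h2 : harmonic n + (((n + 1 : ℕ) : ℚ))⁻¹
          - (harmonic (n / p) + (((n / p + 1 : ℕ) : ℚ))⁻¹) / p
          = harmonic n - harmonic (n / p) / p := by
        rw [h1, mul_inv]
        ring
      rw [h2]
      exact ih
    · rw [Nat.succ_div_of_not_dvd h, harmonic_succ]
      have h2 : harmonic n + (((n + 1 : ℕ) : ℚ))⁻¹ - harmonic (n / p) / p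
          = (harmonic n - harmonic (n / p) / p) + (((n + 1 : ℕ) : ℚ))⁻¹ := by ring
      rw [h2]
      refine padicNorm.nonarchimedean.trans (max_le ih ?_)
      have h3 : padicNorm p ((n + 1 : ℕ) : ℚ) = 1 := (padicNorm.nat_eq_one_iff _).2 h
      rw [← one_div, padicNorm.div, padicNorm.one, h3]
      norm_num

lemma padicNorm_harmonic_div_lt (p : ℕ) [Fact p.Prime] {n a : ℕ}
    (h : padicNorm p (harmonic n) < (p : ℚ) ^ (a + 1)) :
    padicNorm p (harmonic (n / p)) < (p : ℚ) ^ a := by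
  have hp : p.Prime := Fact.out
  have hp1 : (1 : ℚ) < p := by exact_mod_cast hp.one_lt
  have h1 : padicNorm p (harmonic (n / p) / p) < (p : ℚ) ^ (a + 1) := by
    have : harmonic (n / p) / p = harmonic n - (harmonic n - harmonic (n / p) / p) := by ring
    rw [this]
    refine padicNorm.sub.trans_lt (max_lt h ?_)
    exact (padicNorm_harmonic_sub_le p n).trans_lt (one_lt_pow₀ hp1 (by omega))
  rw [padicNorm.div, padicNorm.padicNorm_p_of_prime, div_inv_eq_mul, pow_succ] at h1
  exact lt_of_mul_lt_mul_right h1 (by positivity)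

lemma div_pow_mem_numeratorSet (p : ℕ) [Fact p.Prime] {n a : ℕ}
    (h : padicNorm p (harmonic n) < (p : ℚ) ^ a) : n / p ^ a ∈ numeratorSet p := by
  induction a generalizing n with
  | zero => simpa [numeratorSet] using h
  | succ a ih =>
    rw [pow_succ', ← Nat.div_div_eq_div_mul]
    exact ih (padicNorm_harmonic_div_lt p h)

/-- This gives the tree structure. Its root is 0, which belongs to the set because H_0 = 0. -/
lemma div_mem_numeratorSet (p : ℕ) [hp : Fact p.Prime] {n : ℕ} (h : n ∈ numeratorSet p) :
    n / p ∈ numeratorSet p := by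
  have h1 : padicNorm p (harmonic n) < (p : ℚ) ^ 1 :=
    lt_trans h (by rw [pow_one]; exact_mod_cast hp.out.one_lt)
  simpa using div_pow_mem_numeratorSet p h1

lemma padicNorm_lt_of_not_dvd_den (p : ℕ) [hp : Fact p.Prime] {r : ℚ} {a : ℕ}
    (h : ¬ p ^ a ∣ r.den) : padicNorm p r < (p : ℚ) ^ a := by
  have hp1 : (1 : ℚ) < p := by exact_mod_cast hp.out.one_lt
  rcases eq_or_ne r 0 with rfl | hr
  · simp only [padicNorm.zero]
    positivity
  · rw [padicNorm.eq_zpow_of_nonzero hr, ← zpow_natCast]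
    apply zpow_lt_zpow_right₀ hp1
    rw [padicValNat_dvd_iff_le r.den_nz] at h
    rw [padicValRat]
    have : (0 : ℤ) ≤ padicValInt p r.num := by positivity
    omega

lemma div_pow_mem_numeratorSet_of_not_dvd (p : ℕ) [Fact p.Prime] {n a : ℕ} (h : ¬ p ^ a ∣ v n) :
    n / p ^ a ∈ numeratorSet p :=
  div_pow_mem_numeratorSet p (padicNorm_lt_of_not_dvd_den p h)

/-! ### Gaps in `numeratorSet p` and short intervals -/

/-- Logarithmic derivative of X(X+1)⋯(X+d-1) at n + 1: the sum of 1/(n+i) for 1 ≤ i ≤ d. -/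
lemma eval_derivative_ascPochhammer (n d : ℕ) :
    (((ascPochhammer ℤ d).derivative.eval (n + 1 : ℤ) : ℤ) : ℚ)
      = ((ascPochhammer ℤ d).eval (n + 1 : ℤ) : ℤ) * (harmonic (n + d) - harmonic n) := by
  induction d with
  | zero => simp
  | succ d ih =>
    rw [ascPochhammer_succ_right, ← add_assoc, harmonic_succ]
    simp only [Polynomial.derivative_mul, Polynomial.eval_add, Polynomial.eval_mul,
      Polynomial.eval_X, Polynomial.eval_natCast, Polynomial.derivative_add,
      Polynomial.derivative_X, Polynomial.derivative_natCast, add_zero,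
      mul_one, Int.cast_add, Int.cast_mul, ih]
    push_cast
    have : (n : ℚ) + d + 1 ≠ 0 := by positivity
    field_simp
    ring

lemma dvd_eval_derivative_ascPochhammer (p : ℕ) [Fact p.Prime] {n d : ℕ}
    (h₁ : n ∈ numeratorSet p) (h₂ : n + d ∈ numeratorSet p) :
    (p : ℤ) ∣ (ascPochhammer ℤ d).derivative.eval (n + 1 : ℤ) := by
  rw [← padicNorm.int_lt_one_iff, eval_derivative_ascPochhammer, padicNorm.mul]
  have h3 : padicNorm p (harmonic (n + d) - harmonic n) < 1 :=
    padicNorm.sub.trans_lt (max_lt h₂ h₁)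
  refine lt_of_le_of_lt ?_ h3
  exact mul_le_of_le_one_left (padicNorm.nonneg _) (padicNorm.of_int _)

lemma succ_notMem_numeratorSet (p : ℕ) [hp : Fact p.Prime] {n : ℕ} (h : n ∈ numeratorSet p) :
    n + 1 ∉ numeratorSet p := by
  intro h'
  have := dvd_eval_derivative_ascPochhammer p h h'
  simp only [ascPochhammer_one, Polynomial.derivative_X, Polynomial.eval_one] at this
  exact hp.out.one_lt.ne' (by exact_mod_cast Int.eq_one_of_dvd_one (by positivity) this)

open Classical in
-- Each such n yields a root n + 1 of the derivative mod p, and L ≤ p keeps these roots distinct.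
lemma card_gap_le (p : ℕ) [hp : Fact p.Prime] {s L d : ℕ} (hL : L ≤ p) (hd : 0 < d) (hdp : d < p) :
    ((Finset.Ico s (s + L)).filter
      fun n => n ∈ numeratorSet p ∧ n + d ∈ numeratorSet p).card ≤ d := by
  set f : Polynomial (ZMod p) := (ascPochhammer (ZMod p) d).derivative with hf
  -- The coefficient of degree d - 1 is d, nonzero mod p since 0 < d < p.
  have hf0 : f ≠ 0 := by
    intro h0
    have h1 : f.coeff (d - 1) = 0 := by rw [h0, Polynomial.coeff_zero]
    rw [hf, Polynomial.coeff_derivative, Nat.sub_add_cancel hd] at h1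
    have h2 : (ascPochhammer (ZMod p) d).coeff d = 1 := by
      have := (monic_ascPochhammer (ZMod p) d).coeff_natDegree
      rwa [ascPochhammer_natDegree] at this
    rw [h2, one_mul] at h1
    have h3 : ((d : ℕ) : ZMod p) = 0 := by
      rw [← h1, Nat.cast_sub (by omega : 1 ≤ d)]
      simp
    rw [ZMod.natCast_eq_zero_iff] at h3
    exact absurd (Nat.le_of_dvd hd h3) (by omega)
  have hdeg : f.natDegree ≤ d := by
    refine (Polynomial.natDegree_derivative_le _).trans ?_
    rw [ascPochhammer_natDegree]
    omega
  calc _ ≤ f.roots.toFinset.card := by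
        refine Finset.card_le_card_of_injOn (fun n => ((n + 1 : ℕ) : ZMod p)) ?_ ?_
        · intro n hn
          simp only [Finset.coe_filter, Set.mem_ofPred_eq] at hn
          have h1 := dvd_eval_derivative_ascPochhammer p hn.2.1 hn.2.2
          rw [← ZMod.intCast_zmod_eq_zero_iff_dvd] at h1
          simp only [Finset.mem_coe, Multiset.mem_toFinset, Polynomial.mem_roots hf0,
            Polynomial.IsRoot.def]
          rw [← h1, hf, ← ascPochhammer_map (Int.castRingHom (ZMod p)),
            Polynomial.derivative_map]
          have := Polynomial.eval_intCast_map (Int.castRingHom (ZMod p))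
            (ascPochhammer ℤ d).derivative (n + 1 : ℤ)
          simpa using this
        · intro a ha b hb hab
          simp only [Finset.coe_filter, Set.mem_ofPred_eq, Finset.mem_Ico] at ha hb
          simp only at hab
          rw [ZMod.natCast_eq_natCast_iff] at hab
          have hab' : a ≡ b [MOD p] := Nat.ModEq.add_right_cancel' 1 hab
          rcases le_total a b with h | h
          · have := (Nat.modEq_iff_dvd' h).1 hab'
            have := Nat.eq_zero_of_dvd_of_lt this (by omega)
            omega
          · have := (Nat.modEq_iff_dvd' h).1 hab'.symm
            have := Nat.eq_zero_of_dvd_of_lt this (by omega)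
            omega
    _ ≤ f.roots.card := Multiset.toFinset_card_le _
    _ ≤ d := (Polynomial.card_roots' _).trans hdeg

open Classical in
lemma card_interval_le_of_pow_le (p : ℕ) [hp : Fact p.Prime] {s L D : ℕ} (hL : L ≤ p)
    (hD : D ^ 3 ≤ L) :
    ((Finset.Ico s (s + L)).filter (· ∈ numeratorSet p)).card ≤ D ^ 2 + (L / (D + 1) + 1) := by
  have hDp : D < p := by
    by_contra! h
    have h1 : p ^ 3 ≤ p := (Nat.pow_le_pow_left h 3).trans (hD.trans hL)
    have h2 := hp.out.one_lt
    nlinarith [mul_pos (by omega : 0 < p) (by omega : 0 < p)]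
  set A := (Finset.Ico s (s + L)).filter (· ∈ numeratorSet p) with hA
  -- `B` collects the elements followed by another within distance D. Two elements of `A \ B` differ
  -- by more than D, so they fall in distinct blocks of length D + 1.
  set B := (Finset.Icc 1 D).biUnion fun d =>
    (Finset.Ico s (s + L)).filter fun n => n ∈ numeratorSet p ∧ n + d ∈ numeratorSet p with hB
  have hBcard : B.card ≤ D ^ 2 := by
    have h := Finset.card_biUnion_le_card_mul (Finset.Icc 1 D) (fun d =>
      (Finset.Ico s (s + L)).filter fun n => n ∈ numeratorSet p ∧ n + d ∈ numeratorSet p) D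
      (fun d hd => by
        rw [Finset.mem_Icc] at hd
        exact (card_gap_le p hL hd.1 (by omega)).trans hd.2)
    rw [Nat.card_Icc, Nat.add_sub_cancel, ← sq] at h
    exact h
  have hdiff : (A \ B).card ≤ L / (D + 1) + 1 := by
    rw [← Finset.card_range (L / (D + 1) + 1)]
    refine Finset.card_le_card_of_injOn (fun n => (n - s) / (D + 1)) ?_ ?_
    · intro n hn
      simp only [hA, Finset.coe_sdiff, Finset.coe_filter, Finset.mem_Ico, Set.mem_sdiff,
        Set.mem_ofPred_eq] at hn
      simp only [Finset.coe_range, Set.mem_Iio, Order.lt_add_one_iff]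
      exact Nat.div_le_div_right (by omega)
    · have key : ∀ a ∈ A \ B, ∀ b ∈ A \ B, a < b → (a - s) / (D + 1) ≠ (b - s) / (D + 1) := by
        intro a ha b hb hab h
        rw [Finset.mem_sdiff] at ha hb
        apply ha.2
        have ha1 := ha.1
        have hb1 := hb.1
        simp only [hA, Finset.mem_filter, Finset.mem_Ico] at ha1 hb1
        have h1 := Nat.div_add_mod (a - s) (D + 1)
        have h2 := Nat.div_add_mod (b - s) (D + 1)
        have h3 := Nat.mod_lt (b - s) (by omega : 0 < D + 1)
        rw [h] at h1
        simp only [hB, Finset.mem_biUnion, Finset.mem_filter, Finset.mem_Icc, Finset.mem_Ico]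
        refine ⟨b - a, ⟨by omega, by omega⟩, ha1.1, ha1.2, ?_⟩
        rw [Nat.add_sub_cancel' hab.le]
        exact hb1.2
      intro a ha b hb hab
      rcases lt_trichotomy a b with h | h | h
      · exact absurd hab (key a ha b hb h)
      · exact h
      · exact absurd hab.symm (key b hb a ha h)
  calc A.card ≤ (B ∪ A \ B).card := Finset.card_le_card (by simp)
    _ ≤ B.card + (A \ B).card := Finset.card_union_le _ _
    _ ≤ _ := by gcongr

open Classical in
lemma card_interval_le (p : ℕ) [hp : Fact p.Prime] {s L : ℕ} (hL : L ≤ p) :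
    (((Finset.Ico s (s + L)).filter (· ∈ numeratorSet p)).card : ℝ)
      ≤ 3 * (L : ℝ) ^ (2 / 3 : ℝ) := by
  rcases Nat.eq_zero_or_pos L with rfl | hL0
  · simp
  -- D = ⌊L^{1/3}⌋ balances D² against L/D.
  set c : ℝ := (L : ℝ) ^ (1 / 3 : ℝ) with hc
  have hc1 : 1 ≤ c := Real.one_le_rpow (by exact_mod_cast hL0) (by norm_num)
  have hc3 : c ^ 3 = L := by
    rw [hc, ← Real.rpow_natCast, ← Real.rpow_mul (by positivity)]
    norm_num
  have hc2 : (L : ℝ) ^ (2 / 3 : ℝ) = c ^ 2 := by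
    rw [hc, ← Real.rpow_natCast, ← Real.rpow_mul (by positivity)]
    norm_num
  have hDc : (⌊c⌋₊ : ℝ) ≤ c := Nat.floor_le (by linarith)
  have hcD : c < ⌊c⌋₊ + 1 := Nat.lt_floor_add_one c
  have hD : ⌊c⌋₊ ^ 3 ≤ L := by
    have : ((⌊c⌋₊ ^ 3 : ℕ) : ℝ) ≤ (L : ℝ) := by
      rw [← hc3]
      push_cast
      gcongr
    exact_mod_cast this
  have h1 := card_interval_le_of_pow_le p (s := s) hL hD
  have h2 : (((L / (⌊c⌋₊ + 1) : ℕ)) : ℝ) ≤ c ^ 2 := by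
    refine Nat.cast_div_le.trans ?_
    rw [div_le_iff₀ (by positivity), ← hc3]
    push_cast
    nlinarith [sq_nonneg c]
  calc _ ≤ (((⌊c⌋₊ ^ 2 + (L / (⌊c⌋₊ + 1) + 1) : ℕ)) : ℝ) := by exact_mod_cast h1
    _ ≤ c ^ 2 + (c ^ 2 + 1) := by
        push_cast
        gcongr
    _ ≤ 3 * (L : ℝ) ^ (2 / 3 : ℝ) := by
        rw [hc2]
        nlinarith

open Classical in
-- A saving of one per block, from the absence of consecutive elements; it serves the small primes,
-- where 3p^{2/3} is too weak.
lemma card_interval_le_pred (p : ℕ) [hp : Fact p.Prime] (s : ℕ) :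
    ((Finset.Ico s (s + p)).filter (· ∈ numeratorSet p)).card ≤ p - 1 := by
  have h2 := hp.out.two_le
  by_contra! h
  have h1 : (Finset.Ico s (s + p)).filter (· ∈ numeratorSet p) = Finset.Ico s (s + p) := by
    apply Finset.eq_of_subset_of_card_le (Finset.filter_subset _ _)
    rw [Nat.card_Ico]
    omega
  rw [Finset.filter_eq_self] at h1
  exact succ_notMem_numeratorSet p (h1 s (by simp; omega)) (h1 (s + 1) (by simp; omega))

/-! ### Counting `numeratorSet p` along the tree -/

open Classical in
/-- The number of elements of `numeratorSet p` below `N`. -/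
noncomputable def numeratorCount (p N : ℕ) : ℕ :=
  ((Finset.range N).filter (· ∈ numeratorSet p)).card

lemma numeratorCount_mono (p : ℕ) : Monotone (numeratorCount p) := by
  classical
  exact fun _ _ h => Finset.card_le_card (Finset.filter_subset_filter _ (Finset.range_mono h))

lemma numeratorCount_le (p N : ℕ) : numeratorCount p N ≤ N := by
  classical
  exact (Finset.card_filter_le _ _).trans (Finset.card_range N).le

open Classical in
-- Each m has at most B preimages in the set under division by p; iterate k levels.
lemma numeratorCount_mul_pow_le (p : ℕ) [hp : Fact p.Prime] {B : ℕ}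
    (hB : ∀ s, ((Finset.Ico s (s + p)).filter (· ∈ numeratorSet p)).card ≤ B) (t k : ℕ) :
    numeratorCount p (t * p ^ k) ≤ B ^ k * numeratorCount p t := by
  have hp0 := hp.out.pos
  induction k with
  | zero => simp
  | succ k ih =>
    calc _ ≤ B * numeratorCount p (t * p ^ k) := by
          refine Finset.card_le_mul_card_image_of_maps_to (f := (· / p)) ?_ _ ?_
          · intro n hn
            simp only [Finset.mem_filter, Finset.mem_range] at hn ⊢
            refine ⟨?_, div_mem_numeratorSet p hn.2⟩
            rw [Nat.div_lt_iff_lt_mul hp0, mul_assoc, ← pow_succ]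
            exact hn.1
          · intro m _
            refine le_trans (Finset.card_le_card ?_) (hB (m * p))
            intro n hn
            simp only [Finset.mem_filter, Finset.mem_Ico] at hn ⊢
            refine ⟨?_, hn.1.2⟩
            have h1 := Nat.div_add_mod n p
            have h2 := Nat.mod_lt n hp0
            rw [hn.2, mul_comm] at h1
            omega
      _ ≤ B * (B ^ k * numeratorCount p t) := by gcongr
      _ = _ := by ring

lemma numeratorCount_succ_le (p : ℕ) [hp : Fact p.Prime] {y : ℕ} (hy : 0 < y) :
    (numeratorCount p (y + 1) : ℝ) ≤ 6 * 3 ^ Nat.log p y * (y : ℝ) ^ (2 / 3 : ℝ) := by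
  classical
  have hp1 := hp.out.one_lt
  set k := Nat.log p y with hk
  have hky : p ^ k ≤ y := Nat.pow_log_le_self p hy.ne'
  have hyk : y < p ^ (k + 1) := Nat.lt_pow_succ_log_self hp1 y
  have hpk : 0 < p ^ k := by positivity
  -- Leading base-p digit plus one: t ≤ p, so the short-interval bound applies to the top level,
  -- while y < t p^k ≤ 2y.
  set t := y / p ^ k + 1 with ht
  have htp : t ≤ p := by
    rw [ht, Nat.succ_le_iff, Nat.div_lt_iff_lt_mul hpk, ← pow_succ']
    exact hyk
  have hyt : y + 1 ≤ t * p ^ k := by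
    rw [ht, mul_comm]
    exact Nat.lt_mul_div_succ y hpk
  have ht2 : (t : ℝ) * (p : ℝ) ^ k ≤ 2 * y := by
    have h1 : t * p ^ k ≤ 2 * y := by
      have := Nat.div_mul_le_self y (p ^ k)
      rw [ht, add_mul]
      omega
    exact_mod_cast h1
  set B := ⌊3 * (p : ℝ) ^ (2 / 3 : ℝ)⌋₊ with hBdef
  have hB : ∀ s, ((Finset.Ico s (s + p)).filter (· ∈ numeratorSet p)).card ≤ B := fun s =>
    Nat.le_floor (card_interval_le p le_rfl)
  have hBle : (B : ℝ) ≤ 3 * (p : ℝ) ^ (2 / 3 : ℝ) := Nat.floor_le (by positivity)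
  have ht1 : (numeratorCount p t : ℝ) ≤ 3 * (t : ℝ) ^ (2 / 3 : ℝ) := by
    have := card_interval_le p (s := 0) htp
    rwa [zero_add, Nat.Ico_zero_eq_range] at this
  have h2 : (2 : ℝ) ^ (2 / 3 : ℝ) ≤ 2 := by
    calc (2 : ℝ) ^ (2 / 3 : ℝ) ≤ 2 ^ (1 : ℝ) :=
          Real.rpow_le_rpow_of_exponent_le (by norm_num) (by norm_num)
      _ = 2 := Real.rpow_one 2
  calc (numeratorCount p (y + 1) : ℝ) ≤ ((B ^ k * numeratorCount p t : ℕ) : ℝ) := by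
        exact_mod_cast (numeratorCount_mono p hyt).trans (numeratorCount_mul_pow_le p hB t k)
    _ ≤ (3 * (p : ℝ) ^ (2 / 3 : ℝ)) ^ k * (3 * (t : ℝ) ^ (2 / 3 : ℝ)) := by
        push_cast
        gcongr
    _ = 3 * 3 ^ k * (t * (p : ℝ) ^ k) ^ (2 / 3 : ℝ) := by
        rw [Real.mul_rpow (by positivity) (by positivity), mul_pow,
          Real.rpow_pow_comm (by positivity)]
        ring
    _ ≤ 3 * 3 ^ k * (2 * y) ^ (2 / 3 : ℝ) := by gcongr
    _ = 3 * 3 ^ k * (2 ^ (2 / 3 : ℝ) * y ^ (2 / 3 : ℝ)) := by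
        rw [Real.mul_rpow (by positivity) (by positivity)]
    _ ≤ 3 * 3 ^ k * (2 * y ^ (2 / 3 : ℝ)) := by gcongr
    _ = _ := by ring

lemma numeratorCount_succ_le_mul_pow (p : ℕ) [hp : Fact p.Prime] (y : ℕ) :
    numeratorCount p (y + 1) ≤ p * (p - 1) ^ Nat.log p y := by
  classical
  have hyk : y + 1 ≤ p * p ^ Nat.log p y := by
    rw [← pow_succ']
    exact Nat.lt_pow_succ_log_self hp.out.one_lt y
  calc _ ≤ numeratorCount p (p * p ^ Nat.log p y) := numeratorCount_mono p hyk
    _ ≤ (p - 1) ^ Nat.log p y * numeratorCount p p :=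
        numeratorCount_mul_pow_le p (card_interval_le_pred p) _ _
    _ ≤ (p - 1) ^ Nat.log p y * p := by gcongr; exact numeratorCount_le p p
    _ = _ := mul_comm _ _

/-! ### Contribution of a single prime power q -/

open Classical in
lemma card_div_mem_le (p : ℕ) {q : ℕ} (hq : 0 < q) (X : ℕ) :
    ((Finset.range (X + 1)).filter fun n => n / q ∈ numeratorSet p).card
      ≤ q * numeratorCount p (X / q + 1) := by
  refine Finset.card_le_mul_card_image_of_maps_to (f := (· / q)) ?_ _ ?_
  · intro n hn
    simp only [Finset.mem_filter, Finset.mem_range] at hn ⊢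
    exact ⟨Nat.lt_succ_of_le (Nat.div_le_div_right (by omega)), hn.2⟩
  · intro m _
    calc _ ≤ (Finset.Ico (m * q) (m * q + q)).card := by
          refine Finset.card_le_card fun n hn => ?_
          simp only [Finset.mem_filter, Finset.mem_Ico] at hn ⊢
          have h1 := Nat.div_add_mod n q
          have h2 := Nat.mod_lt n hq
          rw [hn.2, mul_comm] at h1
          omega
      _ = q := by simp

lemma natCast_floor_div_le {x : ℝ} (hx : 0 ≤ x) (q : ℕ) : ((⌊x⌋₊ / q : ℕ) : ℝ) ≤ x / q :=
  Nat.cast_div_le.trans (by gcongr; exact Nat.floor_le hx)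

lemma floor_div_pos {x : ℝ} {q : ℕ} (hx : 1 ≤ x) (hq : 0 < q) (hqx : (q : ℝ) ≤ x ^ (1 / 4 : ℝ)) :
    0 < ⌊x⌋₊ / q := by
  refine Nat.div_pos (Nat.le_floor (hqx.trans ?_)) hq
  calc x ^ (1 / 4 : ℝ) ≤ x ^ (1 : ℝ) := Real.rpow_le_rpow_of_exponent_le hx (by norm_num)
    _ = x := Real.rpow_one x

lemma mul_numeratorCount_le (p : ℕ) [Fact p.Prime] {x : ℝ} {q : ℕ} (hx : 1 ≤ x) (hq : 0 < q)
    (hqx : (q : ℝ) ≤ x ^ (1 / 4 : ℝ)) :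
    (q : ℝ) * numeratorCount p (⌊x⌋₊ / q + 1)
      ≤ 6 * 3 ^ Nat.log p (⌊x⌋₊ / q) * x ^ (3 / 4 : ℝ) := by
  have hx0 : 0 < x := by linarith
  have hq0 : (0 : ℝ) < q := by exact_mod_cast hq
  -- The exponent is 2/3 + (1/4)(1/3) = 3/4.
  have h1 : (q : ℝ) * (x / q) ^ (2 / 3 : ℝ) ≤ x ^ (3 / 4 : ℝ) := by
    calc (q : ℝ) * (x / q) ^ (2 / 3 : ℝ) = x ^ (2 / 3 : ℝ) * (q : ℝ) ^ (1 / 3 : ℝ) := by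
          rw [Real.div_rpow hx0.le hq0.le, show (1 / 3 : ℝ) = 1 - 2 / 3 by norm_num,
            Real.rpow_sub hq0, Real.rpow_one]
          ring
      _ ≤ x ^ (2 / 3 : ℝ) * (x ^ (1 / 4 : ℝ)) ^ (1 / 3 : ℝ) := by gcongr
      _ = x ^ (3 / 4 : ℝ) := by
          rw [← Real.rpow_mul hx0.le, ← Real.rpow_add hx0]
          norm_num
  calc _ ≤ (q : ℝ) * (6 * 3 ^ Nat.log p (⌊x⌋₊ / q) * (x / q) ^ (2 / 3 : ℝ)) := by
        gcongr
        refine (numeratorCount_succ_le p (floor_div_pos hx hq hqx)).trans ?_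
        gcongr
        exact natCast_floor_div_le hx0.le q
    _ = 6 * 3 ^ Nat.log p (⌊x⌋₊ / q) * ((q : ℝ) * (x / q) ^ (2 / 3 : ℝ)) := by ring
    _ ≤ _ := by gcongr

/-- As p^5 > x, the tree has at most 4 levels below the top, and 486 = 6 · 3^4. -/
lemma mul_numeratorCount_le_of_rpow_lt (p : ℕ) [hp : Fact p.Prime] {x : ℝ} {q : ℕ} (hx : 1 ≤ x)
    (hq : 0 < q) (hqx : (q : ℝ) ≤ x ^ (1 / 4 : ℝ)) (hpx : x ^ (1 / 5 : ℝ) < p) :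
    (q : ℝ) * numeratorCount p (⌊x⌋₊ / q + 1) ≤ 486 * x ^ (3 / 4 : ℝ) := by
  have hx0 : 0 < x := by linarith
  have hk : Nat.log p (⌊x⌋₊ / q) ≤ 4 := by
    rw [← Nat.lt_succ_iff]
    apply Nat.log_lt_of_lt_pow (floor_div_pos hx hq hqx).ne'
    refine (Nat.div_le_self _ _).trans_lt ?_
    rw [Nat.floor_lt hx0.le]
    calc x = (x ^ (1 / 5 : ℝ)) ^ 5 := by
          rw [← Real.rpow_natCast, ← Real.rpow_mul hx0.le]
          norm_num
      _ < (p : ℝ) ^ 5 := by gcongr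
      _ = _ := by push_cast; rfl
  calc _ ≤ 6 * 3 ^ Nat.log p (⌊x⌋₊ / q) * x ^ (3 / 4 : ℝ) := mul_numeratorCount_le p hx hq hqx
    _ ≤ 6 * 3 ^ 4 * x ^ (3 / 4 : ℝ) := by gcongr; norm_num
    _ = _ := by norm_num

/-- From p^k ≤ x and p ≥ 3^60 follows 3^k ≤ x^{1/60}, and 3/4 + 1/60 = 23/30. With about x^{1/5}
primes the total exponent is 29/30 < 1. -/
lemma mul_numeratorCount_le_of_pow_le (p : ℕ) [hp : Fact p.Prime] {x : ℝ} {q : ℕ} (hx : 1 ≤ x)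
    (hq : 0 < q) (hqx : (q : ℝ) ≤ x ^ (1 / 4 : ℝ)) (hp60 : 3 ^ 60 ≤ p) :
    (q : ℝ) * numeratorCount p (⌊x⌋₊ / q + 1) ≤ 6 * x ^ (23 / 30 : ℝ) := by
  have hx0 : 0 < x := by linarith
  set k := Nat.log p (⌊x⌋₊ / q) with hk
  have hk3 : (3 : ℝ) ^ k ≤ x ^ (1 / 60 : ℝ) := by
    have h1 : (3 ^ k) ^ 60 ≤ ⌊x⌋₊ := by
      rw [← pow_mul, mul_comm, pow_mul]
      exact (Nat.pow_le_pow_left hp60 k).trans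
        ((Nat.pow_log_le_self p (floor_div_pos hx hq hqx).ne').trans (Nat.div_le_self _ _))
    have h2 : ((3 : ℝ) ^ k) ^ 60 ≤ x := by
      refine le_trans ?_ (Nat.floor_le hx0.le)
      exact_mod_cast h1
    calc (3 : ℝ) ^ k = (((3 : ℝ) ^ k) ^ 60) ^ (1 / 60 : ℝ) := by
          rw [← Real.rpow_natCast ((3 : ℝ) ^ k) 60, ← Real.rpow_mul (by positivity)]
          norm_num
      _ ≤ x ^ (1 / 60 : ℝ) := by gcongr
  calc _ ≤ 6 * 3 ^ k * x ^ (3 / 4 : ℝ) := mul_numeratorCount_le p hx hq hqx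
    _ ≤ 6 * x ^ (1 / 60 : ℝ) * x ^ (3 / 4 : ℝ) := by gcongr
    _ = _ := by
        rw [mul_assoc, ← Real.rpow_add hx0]
        norm_num

lemma exists_pred_le_rpow {M : ℕ} (hM : 1 < M) :
    ∃ η : ℝ, 0 < η ∧ η < 1 ∧ ∀ p : ℕ, 2 ≤ p → p ≤ M → ((p - 1 : ℕ) : ℝ) ≤ (p : ℝ) ^ (1 - η) := by
  have hM0 : (0 : ℝ) < M := by positivity
  have hM1 : (1 : ℝ) < M := by exact_mod_cast hM
  have hlog : 0 < Real.log M := Real.log_pos hM1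
  have hinv : (M : ℝ)⁻¹ < 1 := inv_lt_one_of_one_lt₀ hM1
  -- Chosen so that M^{-η₀} = 1 - 1/M; then 1 - 1/p ≤ 1 - 1/M ≤ p^{-η₀} for p ≤ M.
  set η₀ : ℝ := -Real.log (1 - (M : ℝ)⁻¹) / Real.log M with hη₀
  have hη₀pos : 0 < η₀ := by
    apply div_pos _ hlog
    rw [neg_pos]
    exact Real.log_neg (by linarith) (by have := inv_pos.2 hM0; linarith)
  have key : (M : ℝ) ^ (-η₀) = 1 - (M : ℝ)⁻¹ := by
    rw [Real.rpow_def_of_pos hM0, hη₀, neg_div, neg_neg, mul_div_cancel₀ _ hlog.ne',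
      Real.exp_log (by linarith)]
  refine ⟨min η₀ (1 / 2), lt_min hη₀pos (by norm_num),
    (min_le_right _ _).trans_lt (by norm_num), fun p hp2 hpM => ?_⟩
  have hp0 : (0 : ℝ) < p := by positivity
  have hpM' : (p : ℝ) ≤ M := by exact_mod_cast hpM
  have hp1 : (1 : ℝ) ≤ p := by exact_mod_cast (by omega : 1 ≤ p)
  calc ((p - 1 : ℕ) : ℝ) = p * (1 - (p : ℝ)⁻¹) := by
        rw [Nat.cast_sub (by omega), mul_sub, mul_inv_cancel₀ hp0.ne']
        simp
    _ ≤ p * (1 - (M : ℝ)⁻¹) := by gcongr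
    _ = p * (M : ℝ) ^ (-η₀) := by rw [key]
    _ ≤ p * (p : ℝ) ^ (-η₀) := by
        have := Real.rpow_le_rpow_of_nonpos hp0 hpM' (neg_nonpos.2 hη₀pos.le)
        gcongr
    _ = (p : ℝ) ^ (1 - η₀) := by
        rw [sub_eq_add_neg, Real.rpow_add hp0, Real.rpow_one]
    _ ≤ _ := Real.rpow_le_rpow_of_exponent_le hp1 (by linarith [min_le_left η₀ (1 / 2)])

lemma mul_numeratorCount_le_of_pred_le (p : ℕ) [hp : Fact p.Prime] {x η : ℝ} {q : ℕ} (hx : 1 ≤ x)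
    (hq : 0 < q) (hqx : (q : ℝ) ≤ x ^ (1 / 4 : ℝ)) (hη₀ : 0 < η) (hη₁ : η < 1)
    (hη : ((p - 1 : ℕ) : ℝ) ≤ (p : ℝ) ^ (1 - η)) :
    (q : ℝ) * numeratorCount p (⌊x⌋₊ / q + 1) ≤ p * x ^ (1 - 3 / 4 * η) := by
  have hx0 : 0 < x := by linarith
  have hq0 : (0 : ℝ) < q := by exact_mod_cast hq
  set k := Nat.log p (⌊x⌋₊ / q) with hk
  have h1 : ((p - 1 : ℕ) : ℝ) ^ k ≤ (x / q) ^ (1 - η) := by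
    calc ((p - 1 : ℕ) : ℝ) ^ k ≤ ((p : ℝ) ^ (1 - η)) ^ k := by gcongr
      _ = ((p : ℝ) ^ k) ^ (1 - η) := Real.rpow_pow_comm (by positivity) _ _
      _ ≤ (x / q) ^ (1 - η) := by
          refine Real.rpow_le_rpow (by positivity) ?_ (by linarith)
          refine le_trans ?_ (natCast_floor_div_le hx0.le q)
          exact_mod_cast Nat.pow_log_le_self p (floor_div_pos hx hq hqx).ne'
  calc _ ≤ (q : ℝ) * ((p * (p - 1) ^ k : ℕ) : ℝ) := by
        gcongr
        exact numeratorCount_succ_le_mul_pow p _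
    _ ≤ (q : ℝ) * (p * (x / q) ^ (1 - η)) := by
        rw [Nat.cast_mul, Nat.cast_pow]
        gcongr
    _ = p * (x ^ (1 - η) * (q : ℝ) ^ η) := by
        rw [Real.div_rpow hx0.le hq0.le, Real.rpow_sub hq0, Real.rpow_one]
        field_simp
    _ ≤ p * (x ^ (1 - η) * (x ^ (1 / 4 : ℝ)) ^ η) := by gcongr
    _ = p * x ^ (1 - 3 / 4 * η) := by
        rw [← Real.rpow_mul hx0.le, ← Real.rpow_add hx0]
        ring_nf

/-! ### Union bound for the exceptional set -/

lemma exists_prime_pow_of_mem_exceptionalSet {n : ℕ} (h : n ∈ exceptionalSet) :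
    ∃ p a : ℕ, p.Prime ∧ 0 < a ∧ ((p ^ a : ℕ) : ℝ) ≤ (n : ℝ) ^ (1 / 4 : ℝ) ∧
      n / p ^ a ∈ numeratorSet p := by
  obtain ⟨hn, h⟩ := h
  obtain ⟨i, hi, hiv⟩ : ∃ i ∈ Finset.Icc 1 ⌊(n : ℝ) ^ (1 / 4 : ℝ)⌋₊, ¬ i ∣ v n := by
    by_contra! h'
    exact h (Finset.lcm_dvd h')
  rw [Nat.dvd_iff_prime_pow_dvd_dvd] at hiv
  push Not at hiv
  obtain ⟨p, a, hp, hpi, hpv⟩ := hiv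
  have : Fact p.Prime := ⟨hp⟩
  rw [Finset.mem_Icc] at hi
  refine ⟨p, a, hp, ?_, ?_, div_pow_mem_numeratorSet_of_not_dvd p hpv⟩
  · rw [Nat.pos_iff_ne_zero]
    rintro rfl
    simp at hpv
  · exact (Nat.le_floor_iff (by positivity)).1 ((Nat.le_of_dvd hi.1 hpi).trans hi.2)

lemma natCast_card_biUnion_le {ι α : Type*} [DecidableEq α] (s : Finset ι) (f : ι → Finset α)
    {b : ℝ} (h : ∀ i ∈ s, ((f i).card : ℝ) ≤ b) : ((s.biUnion f).card : ℝ) ≤ s.card * b := by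
  calc ((s.biUnion f).card : ℝ) ≤ ((∑ i ∈ s, (f i).card : ℕ) : ℝ) := by
        exact_mod_cast Finset.card_biUnion_le
    _ = ∑ i ∈ s, ((f i).card : ℝ) := by push_cast; rfl
    _ ≤ s.card • b := Finset.sum_le_card_nsmul _ _ _ h
    _ = _ := nsmul_eq_mul _ _

open Classical in
lemma natCast_card_div_mem_le (p : ℕ) {q : ℕ} (hq : 0 < q) (X : ℕ) {b : ℝ}
    (hb : (q : ℝ) * numeratorCount p (X / q + 1) ≤ b) :
    (((Finset.range (X + 1)).filter fun n => n / q ∈ numeratorSet p).card : ℝ) ≤ b :=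
  le_trans (by exact_mod_cast card_div_mem_le p hq X) hb

lemma countingFunction_exceptionalSet_le {x η : ℝ} {M : ℕ} (hx : 1 ≤ x) (hη₀ : 0 < η)
    (hη₁ : η < 1) (hM : M = 3 ^ 60)
    (hη : ∀ p : ℕ, 2 ≤ p → p ≤ M → ((p - 1 : ℕ) : ℝ) ≤ (p : ℝ) ^ (1 - η)) :
    (countingFunction exceptionalSet x : ℝ) ≤
      Nat.primeCounting ⌊x ^ (1 / 4 : ℝ)⌋₊ * (486 * x ^ (3 / 4 : ℝ))
      + (⌊x ^ (1 / 5 : ℝ)⌋₊ + 1) * (Nat.log 2 ⌊x⌋₊ + 1) * (6 * x ^ (23 / 30 : ℝ))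
      + M * (Nat.log 2 ⌊x⌋₊ + 1) * (M * x ^ (1 - 3 / 4 * η)) := by
  classical
  have hx0 : 0 < x := by linarith
  set X := ⌊x⌋₊ with hX
  set E : ℕ → ℕ → Finset ℕ := fun p q =>
    (Finset.range (X + 1)).filter fun n => n / q ∈ numeratorSet p with hE
  set A := Nat.log 2 X + 1 with hA
  set I₁ := (Nat.primesLE ⌊x ^ (1 / 4 : ℝ)⌋₊).filter fun p : ℕ => x ^ (1 / 5 : ℝ) < (p : ℝ) with hI₁
  set I₂ := (Finset.range (⌊x ^ (1 / 5 : ℝ)⌋₊ + 1) ×ˢ Finset.range A).filter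
    fun i => i.1.Prime ∧ M ≤ i.1 ∧ ((i.1 ^ i.2 : ℕ) : ℝ) ≤ x ^ (1 / 4 : ℝ) with hI₂
  set I₃ := (Finset.range M ×ˢ Finset.range A).filter
    fun i => i.1.Prime ∧ ((i.1 ^ i.2 : ℕ) : ℝ) ≤ x ^ (1 / 4 : ℝ) with hI₃
  have hcover : {n : ℕ | n ∈ exceptionalSet ∧ 1 ≤ n ∧ (n : ℝ) ≤ x} ⊆
      ((I₁.biUnion (fun p => E p p) ∪ I₂.biUnion (fun i => E i.1 (i.1 ^ i.2))
        ∪ I₃.biUnion (fun i => E i.1 (i.1 ^ i.2)) : Finset ℕ) : Set ℕ) := by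
    rintro n ⟨hn, hn1, hnx⟩
    obtain ⟨p, a, hp, ha, hpa, hmem⟩ := exists_prime_pow_of_mem_exceptionalSet hn
    have hpax : ((p ^ a : ℕ) : ℝ) ≤ x ^ (1 / 4 : ℝ) := hpa.trans (by gcongr)
    have hnE : n ∈ E p (p ^ a) := by
      rw [hE, Finset.mem_filter, Finset.mem_range]
      exact ⟨Nat.lt_succ_of_le (Nat.le_floor hnx), hmem⟩
    have haA : a ∈ Finset.range A := by
      rw [Finset.mem_range, hA, Nat.lt_succ_iff]
      refine Nat.le_log_of_pow_le (by norm_num) ?_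
      refine (Nat.pow_le_pow_left hp.two_le a).trans (Nat.le_floor (hpax.trans ?_))
      calc x ^ (1 / 4 : ℝ) ≤ x ^ (1 : ℝ) := Real.rpow_le_rpow_of_exponent_le hx (by norm_num)
        _ = x := Real.rpow_one x
    simp only [Finset.coe_union, Set.mem_union, Finset.mem_coe, Finset.mem_biUnion]
    by_cases hpM : p < M
    · refine Or.inr ⟨(p, a), ?_, hnE⟩
      rw [hI₃, Finset.mem_filter, Finset.mem_product]
      exact ⟨⟨Finset.mem_range.2 hpM, haA⟩, hp, hpax⟩
    by_cases hpx : x ^ (1 / 5 : ℝ) < (p : ℝ)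
    -- Otherwise p^a ≥ p² > x^{2/5} ≥ x^{1/4}.
    · have ha1 : a = 1 := by
        by_contra hne
        have h2 : p ^ 2 ≤ p ^ a := Nat.pow_le_pow_right hp.pos (by omega)
        have h3 : ((p ^ 2 : ℕ) : ℝ) ≤ x ^ (1 / 4 : ℝ) :=
          le_trans (by exact_mod_cast h2) hpax
        have h4 : x ^ (2 / 5 : ℝ) < ((p ^ 2 : ℕ) : ℝ) := by
          calc x ^ (2 / 5 : ℝ) = (x ^ (1 / 5 : ℝ)) ^ 2 := by
                rw [← Real.rpow_natCast, ← Real.rpow_mul hx0.le]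
                norm_num
            _ < (p : ℝ) ^ 2 := by gcongr
            _ = _ := by push_cast; rfl
        have h5 : x ^ (1 / 4 : ℝ) ≤ x ^ (2 / 5 : ℝ) :=
          Real.rpow_le_rpow_of_exponent_le hx (by norm_num)
        linarith
      subst ha1
      rw [pow_one] at hpax hnE
      refine Or.inl (Or.inl ⟨p, ?_, hnE⟩)
      rw [hI₁, Finset.mem_filter, Nat.mem_primesLE]
      exact ⟨⟨Nat.le_floor hpax, hp⟩, hpx⟩
    · refine Or.inl (Or.inr ⟨(p, a), ?_, hnE⟩)
      rw [hI₂, Finset.mem_filter, Finset.mem_product]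
      exact ⟨⟨Finset.mem_range.2 (Nat.lt_succ_of_le (Nat.le_floor (not_lt.1 hpx))), haA⟩, hp,
        not_lt.1 hpM, hpax⟩
  have hcount : countingFunction exceptionalSet x ≤ (I₁.biUnion (fun p => E p p)).card
      + (I₂.biUnion (fun i => E i.1 (i.1 ^ i.2))).card
      + (I₃.biUnion (fun i => E i.1 (i.1 ^ i.2))).card := by
    refine (Set.ncard_le_ncard hcover (Finset.finite_toSet _)).trans ?_
    rw [Set.ncard_coe_finset]
    exact (Finset.card_union_le _ _).trans (by gcongr; exact Finset.card_union_le _ _)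
  have hb₁ : ((I₁.biUnion (fun p => E p p)).card : ℝ) ≤
      Nat.primeCounting ⌊x ^ (1 / 4 : ℝ)⌋₊ * (486 * x ^ (3 / 4 : ℝ)) := by
    refine (natCast_card_biUnion_le I₁ _ (b := 486 * x ^ (3 / 4 : ℝ)) ?_).trans ?_
    · intro p hp
      rw [hI₁, Finset.mem_filter, Nat.mem_primesLE] at hp
      have : Fact p.Prime := ⟨hp.1.2⟩
      exact natCast_card_div_mem_le p hp.1.2.pos X (mul_numeratorCount_le_of_rpow_lt p hx
        hp.1.2.pos ((Nat.le_floor_iff (by positivity)).1 hp.1.1) hp.2)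
    · rw [← Nat.primesLE_card_eq_primeCounting]
      gcongr
      exact Finset.filter_subset _ _
  have hb₂ : ((I₂.biUnion (fun i => E i.1 (i.1 ^ i.2))).card : ℝ) ≤
      (⌊x ^ (1 / 5 : ℝ)⌋₊ + 1) * A * (6 * x ^ (23 / 30 : ℝ)) := by
    refine (natCast_card_biUnion_le I₂ _ (b := 6 * x ^ (23 / 30 : ℝ)) ?_).trans ?_
    · intro i hi
      rw [hI₂, Finset.mem_filter] at hi
      have : Fact i.1.Prime := ⟨hi.2.1⟩
      exact natCast_card_div_mem_le i.1 (pow_pos hi.2.1.pos _) X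
        (mul_numeratorCount_le_of_pow_le i.1 hx (pow_pos hi.2.1.pos _) hi.2.2.2
          (hM ▸ hi.2.2.1))
    · gcongr
      refine (Nat.cast_le.2 (Finset.card_filter_le _ _)).trans ?_
      rw [Finset.card_product, Finset.card_range, Finset.card_range]
      push_cast
      rfl
  have hb₃ : ((I₃.biUnion (fun i => E i.1 (i.1 ^ i.2))).card : ℝ) ≤
      M * A * (M * x ^ (1 - 3 / 4 * η)) := by
    refine (natCast_card_biUnion_le I₃ _ (b := M * x ^ (1 - 3 / 4 * η)) ?_).trans ?_
    · intro i hi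
      rw [hI₃, Finset.mem_filter, Finset.mem_product, Finset.mem_range] at hi
      have : Fact i.1.Prime := ⟨hi.2.1⟩
      refine natCast_card_div_mem_le i.1 (pow_pos hi.2.1.pos _) X
        ((mul_numeratorCount_le_of_pred_le i.1 hx (pow_pos hi.2.1.pos _) hi.2.2 hη₀ hη₁
          (hη _ hi.2.1.two_le hi.1.1.le)).trans ?_)
      have := hi.1.1.le
      gcongr
    · gcongr
      refine (Nat.cast_le.2 (Finset.card_filter_le _ _)).trans ?_
      rw [Finset.card_product, Finset.card_range, Finset.card_range, Nat.cast_mul]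
  calc (countingFunction exceptionalSet x : ℝ) ≤ _ := Nat.cast_le.2 hcount
    _ = ((I₁.biUnion (fun p => E p p)).card : ℝ)
      + ((I₂.biUnion (fun i => E i.1 (i.1 ^ i.2))).card : ℝ)
      + ((I₃.biUnion (fun i => E i.1 (i.1 ^ i.2))).card : ℝ) := by push_cast; rfl
    _ ≤ _ := add_le_add (add_le_add hb₁ hb₂) hb₃
    _ = _ := by rw [hA]; push_cast; rfl

/-! ### Asymptotics and density -/

lemma eventually_rpow_mul_log_le {δ : ℝ} (hδ : δ < 1) :
    ∀ᶠ x : ℝ in atTop, x ^ δ * Real.log x ≤ x / Real.log x := by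
  have h := (isLittleO_log_rpow_rpow_atTop 2 (sub_pos.2 hδ)).bound one_pos
  filter_upwards [h, eventually_gt_atTop 1] with x hx hx1
  have hx0 : 0 < x := by linarith
  have hlog : 0 < Real.log x := Real.log_pos hx1
  rw [one_mul, Real.norm_of_nonneg (by positivity), Real.norm_of_nonneg (by positivity),
    Real.rpow_two] at hx
  rw [le_div_iff₀ hlog]
  calc x ^ δ * Real.log x * Real.log x = x ^ δ * Real.log x ^ 2 := by ring
    _ ≤ x ^ δ * x ^ (1 - δ) := by gcongr
    _ = x := by rw [← Real.rpow_add hx0, add_sub_cancel, Real.rpow_one]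

lemma isBigO_countingFunction_exceptionalSet :
    (fun x : ℝ => (countingFunction exceptionalSet x : ℝ))
      =O[atTop] (fun x : ℝ => x / Real.log x) := by
  obtain ⟨M, hM⟩ : ∃ M : ℕ, M = 3 ^ 60 := ⟨_, rfl⟩
  obtain ⟨η, hη₀, hη₁, hη⟩ := exists_pred_le_rpow (M := M) (by rw [hM]; norm_num)
  have hpi := (tendsto_rpow_atTop (by norm_num : (0 : ℝ) < 1 / 4)).eventually
    (Chebyshev.eventually_primeCounting_le one_pos)
  -- The three ranges in turn: Chebyshev's constant log 4 + 1, times 4 from log x^{1/4} = (log x)/4,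
  -- times 486; then 36 = 2 · 3 · 6; then 3M².
  refine IsBigO.of_bound ((Real.log 4 + 1) * 4 * 486 + 36 + 3 * M ^ 2) ?_
  filter_upwards [hpi, eventually_rpow_mul_log_le (by norm_num : (29 / 30 : ℝ) < 1),
    eventually_rpow_mul_log_le (by linarith : 1 - 3 / 4 * η < 1),
    Real.tendsto_log_atTop.eventually_ge_atTop 1, eventually_gt_atTop 1] with x h₁ h₂ h₃ hlog hx
  have hx0 : 0 < x := by linarith
  have hlog0 : 0 < Real.log x := by linarith
  have hA : (Nat.log 2 ⌊x⌋₊ : ℝ) + 1 ≤ 3 * Real.log x := by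
    have hX0 : ⌊x⌋₊ ≠ 0 := (Nat.floor_pos.2 hx.le).ne'
    have h4 : ((2 ^ Nat.log 2 ⌊x⌋₊ : ℕ) : ℝ) ≤ x :=
      (Nat.cast_le.2 (Nat.pow_log_le_self 2 hX0)).trans (Nat.floor_le hx0.le)
    have h5 := Real.log_le_log (by positivity) h4
    rw [Nat.cast_pow, Real.log_pow, Nat.cast_ofNat] at h5
    have h6 : (1 / 2 : ℝ) ≤ Real.log 2 := by linarith [Real.log_two_gt_d9]
    have h7 := mul_le_mul_of_nonneg_left h6 (Nat.cast_nonneg (α := ℝ) (Nat.log 2 ⌊x⌋₊))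
    linarith
  have hfl : (⌊x ^ (1 / 5 : ℝ)⌋₊ : ℝ) + 1 ≤ 2 * x ^ (1 / 5 : ℝ) := by
    have h4 := Nat.floor_le (by positivity : 0 ≤ x ^ (1 / 5 : ℝ))
    have h5 : 1 ≤ x ^ (1 / 5 : ℝ) := Real.one_le_rpow hx.le (by norm_num)
    linarith
  have ht₁ : (Nat.primeCounting ⌊x ^ (1 / 4 : ℝ)⌋₊ : ℝ) * (486 * x ^ (3 / 4 : ℝ))
      ≤ (Real.log 4 + 1) * 4 * 486 * (x / Real.log x) := by
    calc _ ≤ (Real.log 4 + 1) * x ^ (1 / 4 : ℝ) / Real.log (x ^ (1 / 4 : ℝ))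
          * (486 * x ^ (3 / 4 : ℝ)) := by gcongr
      _ = (Real.log 4 + 1) * 4 * 486 * ((x ^ (1 / 4 : ℝ) * x ^ (3 / 4 : ℝ)) / Real.log x) := by
          rw [Real.log_rpow hx0]
          field_simp
      _ = _ := by
          rw [← Real.rpow_add hx0]
          norm_num
  have ht₂ : ((⌊x ^ (1 / 5 : ℝ)⌋₊ : ℝ) + 1) * (Nat.log 2 ⌊x⌋₊ + 1) * (6 * x ^ (23 / 30 : ℝ))
      ≤ 36 * (x / Real.log x) := by
    calc _ ≤ (2 * x ^ (1 / 5 : ℝ)) * (3 * Real.log x) * (6 * x ^ (23 / 30 : ℝ)) := by gcongr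
      _ = 36 * ((x ^ (1 / 5 : ℝ) * x ^ (23 / 30 : ℝ)) * Real.log x) := by ring
      _ = 36 * (x ^ (29 / 30 : ℝ) * Real.log x) := by
          rw [← Real.rpow_add hx0]
          norm_num
      _ ≤ _ := by gcongr
  have ht₃ : (M : ℝ) * (Nat.log 2 ⌊x⌋₊ + 1) * (M * x ^ (1 - 3 / 4 * η))
      ≤ 3 * M ^ 2 * (x / Real.log x) := by
    calc _ ≤ (M : ℝ) * (3 * Real.log x) * (M * x ^ (1 - 3 / 4 * η)) := by gcongr
      _ = 3 * M ^ 2 * (x ^ (1 - 3 / 4 * η) * Real.log x) := by ring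
      _ ≤ _ := by gcongr
  have h := countingFunction_exceptionalSet_le hx.le hη₀ hη₁ hM hη
  rw [Real.norm_of_nonneg (Nat.cast_nonneg _), Real.norm_of_nonneg (by positivity)]
  linarith

lemma countingFunction_goodSet_add (x : ℝ) (hx : 0 ≤ x) :
    countingFunction goodSet x + countingFunction exceptionalSet x = ⌊x⌋₊ := by
  have hsub : ∀ S : Set ℕ, {n : ℕ | n ∈ S ∧ 1 ≤ n ∧ (n : ℝ) ≤ x} ⊆
      (Finset.Icc 1 ⌊x⌋₊ : Finset ℕ) := by
    rintro S n ⟨-, h1, h2⟩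
    exact Finset.mem_coe.2 (Finset.mem_Icc.2 ⟨h1, Nat.le_floor h2⟩)
  have hfin := fun S => (Finset.finite_toSet _).subset (hsub S)
  rw [countingFunction, countingFunction, ← Set.ncard_union_eq ?_ (hfin _) (hfin _)]
  · have : {n : ℕ | n ∈ goodSet ∧ 1 ≤ n ∧ (n : ℝ) ≤ x}
        ∪ {n : ℕ | n ∈ exceptionalSet ∧ 1 ≤ n ∧ (n : ℝ) ≤ x} = (Finset.Icc 1 ⌊x⌋₊ : Finset ℕ) := by
      refine (Set.union_subset (hsub _) (hsub _)).antisymm fun n hn => ?_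
      rw [Finset.mem_coe, Finset.mem_Icc] at hn
      have hnx : (n : ℝ) ≤ x := (Nat.le_floor_iff hx).1 hn.2
      by_cases h : lcmUpTo ⌊(n : ℝ) ^ (1 / 4 : ℝ)⌋₊ ∣ v n
      · exact Or.inl ⟨⟨hn.1, h⟩, hn.1, hnx⟩
      · exact Or.inr ⟨⟨hn.1, h⟩, hn.1, hnx⟩
    rw [this, Set.ncard_coe_finset, Nat.card_Icc, Nat.add_sub_cancel]
  · rw [Set.disjoint_left]
    rintro n ⟨h1, -⟩ ⟨h2, -⟩
    exact h2.2 h1.2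

lemma hasNaturalDensity_goodSet : HasNaturalDensity goodSet 1 := by
  have h1 : (fun x : ℝ => (countingFunction exceptionalSet x : ℝ)) =o[atTop] fun x : ℝ => x := by
    refine isBigO_countingFunction_exceptionalSet.trans_isLittleO ?_
    have h2 : (fun x : ℝ => (Real.log x)⁻¹) =o[atTop] fun _ : ℝ => (1 : ℝ) :=
      (isLittleO_one_iff ℝ).2 Real.tendsto_log_atTop.inv_tendsto_atTop
    simpa [div_eq_mul_inv] using (isBigO_refl (fun x : ℝ => x) atTop).mul_isLittleO h2
  have h3 := (tendsto_nat_floor_div_atTop (R := ℝ)).sub h1.tendsto_div_nhds_zero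
  rw [sub_zero] at h3
  refine h3.congr' ?_
  filter_upwards [eventually_ge_atTop 0] with x hx
  rw [← countingFunction_goodSet_add x hx, ← sub_div]
  push_cast
  ring

end HarmonicDen

theorem theorem1 :
    HarmonicDen.HasNaturalDensity HarmonicDen.goodSet 1 ∧
      (fun x : ℝ => (HarmonicDen.countingFunction HarmonicDen.exceptionalSet x : ℝ))
        =O[atTop] (fun x : ℝ => x / Real.log x) := by
  exact ⟨HarmonicDen.hasNaturalDensity_goodSet,
    HarmonicDen.isBigO_countingFunction_exceptionalSet⟩
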